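/- **Finite-dimensionality of free dioperads.** Let $k$ be a field. A $\Sigma$-bimodule $E=\{E(m,n)\}_{m,n\ge 0}$ is a collection of $k$-vector spaces $E(m,n)$ with commuting linear left $\Sigma_m$- and right $\Sigma_n$-actions; for finite sets $Y,X$ with $m$ and $n$ elements put $$E(Y,X):=\{\text{bijections }[m]\to Y\}\times_{\Sigma_m}E(m,n)\times_{\Sigma_n}\{\text{bijections }X\to[n]\}.$$ A directed $(m,n)$-graph is a finite graph with legs (given by half-edges), with directed edges and no directed cycles, whose input legs are labelled by $1,\dots,n$ and whose output legs are labelled by $1,\dots,m$. A directed $(m,n)$-tree is a (nonempty) connected and simply connected directed $(m,n)$-graph or, if $m=n=1$, the exceptional graph $\uparrow$ consisting of a single directed edge without vertices. For a directed tree $T$ let $E(T):=\bigotimes_{v}E(\mathrm{Out}(v),\mathrm{in}(v))$, the tensor product over all vertices of $T$, where $\mathrm{Out}(v)$ and $\mathrm{in}(v)$ are the sets of outgoing and incoming half-edges at $v$ (so $E(\uparrow)=k$). The component $\Gamma_D(E)(m,n)$ of the free dioperad on $E$ is the colimit of $T\mapsto E(T)$ over the category of directed $(m,n)$-trees and their isomorphisms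 (preserving directions and labels). A directed tree is reduced if each of its vertices has at least three adjacent half-edges. Let $E$ be a $\Sigma$-bimodule with $E(m,n)=0$ whenever $m+n\le 2$. Then: 1. If $E(m,n)$ is finite-dimensional for all $m,n$ with $m+n>2$, then $\Gamma_D(E)(m,n)$ is finite-dimensional for all $m,n\ge 0$. 2. For all $m,n\ge0$ there are only finitely many isomorphism classes of reduced directed $(m,n)$-trees, and there are representatives $T_1,\dots,T_r$, exactly one of each class, for which the canonical map $$\bigoplus_{i=1}^{r}E(T_i)\longrightarrow \Gamma_D(E)(m,n)$$ is an isomorphism. -/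

import Mathlib

open scoped DirectSum TensorProduct

noncomputable section

universe u w

/-- A `Σ`-bimodule over `k`: for all `m, n ≥ 0` a `k`-module `E(m,n)` with a `k`-linear left action of
the symmetric group `Σ_m` and a `k`-linear right action of `Σ_n` that commute. A right action is
recorded as an action of the opposite group. -/
structure SigmaBimodule (k : Type w) [CommRing k] where
  carrier : ℕ → ℕ → Type u
  [addCommGroup : ∀ m n, AddCommGroup (carrier m n)]
  [module : ∀ m n, Module k (carrier m n)]
  left : ∀ m n, Representation k (Equiv.Perm (Fin m)) (carrier m n)
  right : ∀ m n, Representation k (Equiv.Perm (Fin n))ᵐᵒᵖ (carrier m n)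
  left_right_comm : ∀ m n (s : Equiv.Perm (Fin m)) (t : (Equiv.Perm (Fin n))ᵐᵒᵖ) (e : carrier m n),
    left m n s (right m n t e) = right m n t (left m n s e)

attribute [instance] SigmaBimodule.addCommGroup SigmaBimodule.module

/-- The pairs in `Bij(Y,[m]) × Bij([n],X)`, that is, bijections `[m] ≃ Y` and `X ≃ [n]`. The numbers
`m` and `n` are part of the datum; they are necessarily the cardinalities of `Y` and `X`. -/
structure Frame (Y X : Type) where
  m : ℕ
  n : ℕ
  outB : Fin m ≃ Y
  inB : X ≃ Fin n

/-- `(β, α) ↦ (β ∘ σ, τ ∘ α)`. -/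
abbrev Frame.twist {Y X : Type} (p : Frame Y X) (s : Equiv.Perm (Fin p.m)) (t : Equiv.Perm (Fin p.n)) :
    Frame Y X :=
  ⟨p.m, p.n, s.trans p.outB, p.inB.trans t⟩

/-- Transport of a pair along bijections `Y ≃ Y'` and `X ≃ X'`. -/
abbrev Frame.map {Y X Y' X' : Type} (f : Y ≃ Y') (g : X ≃ X') (p : Frame Y X) : Frame Y' X' :=
  ⟨p.m, p.n, p.outB.trans f, g.symm.trans p.inB⟩

namespace SigmaBimodule

variable {k : Type w} [CommRing k] (E : SigmaBimodule.{u} k)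

/-- The direct sum of copies of `E(m,n)` indexed by `Bij(Y,[m]) × Bij([n],X)`. -/
abbrev PreOnSets (Y X : Type) : Type _ := ⨁ p : Frame Y X, E.carrier p.m p.n

open Classical in
/-- The relations `(β ∘ σ, e, τ ∘ α) ~ (β, σ e τ, α)` that define the product over `Σ_m` and `Σ_n`. -/
def onSetsRel (Y X : Type) : Submodule k (E.PreOnSets Y X) :=
  Submodule.span k { x | ∃ (p : Frame Y X) (s : Equiv.Perm (Fin p.m)) (t : Equiv.Perm (Fin p.n))
    (e : E.carrier p.m p.n),
    x = DirectSum.lof k (Frame Y X) (fun p => E.carrier p.m p.n) (p.twist s t) e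
      - DirectSum.lof k (Frame Y X) (fun p => E.carrier p.m p.n) p
          (E.left p.m p.n s (E.right p.m p.n (MulOpposite.op t) e)) }

/-- `E(Y,X) = Bij(Y,[m]) ×_{Σ_m} E(m,n) ×_{Σ_n} Bij([n],X)` for finite sets `Y`, `X` with `m` and `n`
elements. -/
abbrev OnSets (Y X : Type) : Type _ := E.PreOnSets Y X ⧸ E.onSetsRel Y X

open Classical in
/-- The map of direct sums induced by bijections `Y ≃ Y'` and `X ≃ X'`. -/
def preOnSetsMap {Y X Y' X' : Type} (f : Y ≃ Y') (g : X ≃ X') :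
    E.PreOnSets Y X →ₗ[k] E.PreOnSets Y' X' :=
  DirectSum.toModule k (Frame Y X) (E.PreOnSets Y' X') fun p =>
    DirectSum.lof k (Frame Y' X') (fun q => E.carrier q.m q.n) (p.map f g)

theorem onSetsRel_le {Y X Y' X' : Type} (f : Y ≃ Y') (g : X ≃ X') :
    E.onSetsRel Y X ≤ (E.onSetsRel Y' X').comap (E.preOnSetsMap f g) := by
  classical
  refine Submodule.span_le.2 ?_
  rintro x ⟨p, s, t, e, rfl⟩
  refine Submodule.subset_span ⟨p.map f g, s, t, e, ?_⟩
  rw [map_sub]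
  unfold preOnSetsMap
  rw [DirectSum.toModule_lof, DirectSum.toModule_lof]
  rfl

/-- The map `E(Y,X) → E(Y',X')` induced by bijections `Y ≃ Y'` and `X ≃ X'`. -/
def onSetsMap {Y X Y' X' : Type} (f : Y ≃ Y') (g : X ≃ X') :
    E.OnSets Y X →ₗ[k] E.OnSets Y' X' :=
  Submodule.mapQ _ _ (E.preOnSetsMap f g) (E.onSetsRel_le f g)

end SigmaBimodule

/-- A directed `(m,n)`-graph: a finite graph given by half-edges (flags), each adjacent to a vertex, and
an involution `inv` whose two-cycles are the edges and whose fixed points are the legs. Every edge is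
directed: `isOut f` says that the flag `f` leaves the vertex it is adjacent to. There are no directed
cycles, the input legs are labelled by `Fin n` and the output legs by `Fin m`. -/
structure DirGraph (m n : ℕ) where
  Vert : Type
  Flag : Type
  [finiteVert : Finite Vert]
  [finiteFlag : Finite Flag]
  root : Flag → Vert
  inv : Flag → Flag
  inv_inv : ∀ f, inv (inv f) = f
  isOut : Flag → Prop
  isOut_inv : ∀ f, inv f ≠ f → (isOut (inv f) ↔ ¬ isOut f)
  no_directed_cycle : ∀ v, ¬ Relation.TransGen
    (fun a b => ∃ f, inv f ≠ f ∧ isOut f ∧ root f = a ∧ root (inv f) = b) v v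
  outLabel : {f : Flag // inv f = f ∧ isOut f} ≃ Fin m
  inLabel : {f : Flag // inv f = f ∧ ¬ isOut f} ≃ Fin n

namespace DirGraph

variable {m n : ℕ}

/-- The set `Out(v)` of outgoing flags at `v`. -/
abbrev Out (G : DirGraph m n) (v : G.Vert) : Type := {f : G.Flag // G.root f = v ∧ G.isOut f}

/-- The set `in(v)` of incoming flags at `v`. -/
abbrev In (G : DirGraph m n) (v : G.Vert) : Type := {f : G.Flag // G.root f = v ∧ ¬ G.isOut f}

/-- A subdivision of the geometric realization of `G`: one point for every vertex and one for every
flag; a flag is joined to its vertex, and the two flags of an edge are joined to each other. Hence a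
loop of `G` becomes a triangle and a double edge a hexagon. -/
def realization (G : DirGraph m n) : SimpleGraph (G.Vert ⊕ G.Flag) :=
  SimpleGraph.fromRel fun x y => match x, y with
    | Sum.inl v, Sum.inr f => G.root f = v
    | Sum.inr f, Sum.inr g => G.inv f = g
    | _, _ => False

/-- `G` is connected and simply connected. -/
def IsSimplyConnected (G : DirGraph m n) : Prop :=
  G.realization.Connected ∧ G.realization.IsAcyclic

/-- Isomorphisms of directed `(m,n)`-graphs; they preserve directions and labels of the legs. -/
structure Iso (G H : DirGraph m n) where
  vert : G.Vert ≃ H.Vert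
  flag : G.Flag ≃ H.Flag
  root_flag : ∀ f, H.root (flag f) = vert (G.root f)
  inv_flag : ∀ f, H.inv (flag f) = flag (G.inv f)
  isOut_flag : ∀ f, H.isOut (flag f) ↔ G.isOut f
  outLabel_flag : ∀ (f : {f : G.Flag // G.inv f = f ∧ G.isOut f})
    (f' : {f : H.Flag // H.inv f = f ∧ H.isOut f}), f'.1 = flag f.1 → H.outLabel f' = G.outLabel f
  inLabel_flag : ∀ (f : {f : G.Flag // G.inv f = f ∧ ¬ G.isOut f})
    (f' : {f : H.Flag // H.inv f = f ∧ ¬ H.isOut f}), f'.1 = flag f.1 → H.inLabel f' = G.inLabel f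

/-- The bijection `Out(v) ≃ Out(φ v)` induced by an isomorphism `φ`. -/
def Iso.out {G H : DirGraph m n} (φ : G.Iso H) (v : G.Vert) : G.Out v ≃ H.Out (φ.vert v) :=
  φ.flag.subtypeEquiv fun f => by
    rw [φ.root_flag, φ.isOut_flag, φ.vert.apply_eq_iff_eq]

/-- The bijection `in(v) ≃ in(φ v)` induced by an isomorphism `φ`. -/
def Iso.in' {G H : DirGraph m n} (φ : G.Iso H) (v : G.Vert) : G.In v ≃ H.In (φ.vert v) :=
  φ.flag.subtypeEquiv fun f => by
    rw [φ.root_flag, φ.isOut_flag, φ.vert.apply_eq_iff_eq]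

end DirGraph

/-- The objects of the category of extended connected simply connected directed `(m,n)`-graphs: the
connected simply connected directed `(m,n)`-graphs and, for `m = n = 1`, the exceptional graph `↑` with
one input, one output and no vertices. -/
inductive DirTree (m n : ℕ) where
  | exceptional (hm : m = 1) (hn : n = 1) : DirTree m n
  | ofGraph (G : DirGraph m n) (hG : G.IsSimplyConnected) : DirTree m n

namespace DirTree

variable {m n : ℕ}

/-- Vertices; the exceptional graph has none. -/
def Vert : DirTree m n → Type
  | exceptional _ _ => Empty
  | ofGraph G _ => G.Vert

/-- Outgoing flags at a vertex. -/
def Out : (T : DirTree m n) → T.Vert → Type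
  | exceptional _ _, v => nomatch (show Empty from v)
  | ofGraph G _, v => G.Out v

/-- Incoming flags at a vertex. -/
def In : (T : DirTree m n) → T.Vert → Type
  | exceptional _ _, v => nomatch (show Empty from v)
  | ofGraph G _, v => G.In v

/-- Isomorphisms; the exceptional graph has only the identity. -/
def Iso : DirTree m n → DirTree m n → Type
  | exceptional _ _, exceptional _ _ => Unit
  | ofGraph G _, ofGraph H _ => G.Iso H
  | _, _ => Empty

/-- A tree is reduced if every vertex has at least three adjacent flags. -/
def IsReduced (T : DirTree m n) : Prop :=
  ∀ v : T.Vert, 3 ≤ Nat.card (T.Out v) + Nat.card (T.In v)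

end DirTree

namespace SigmaBimodule

variable {k : Type w} [CommRing k] (E : SigmaBimodule.{u} k) {m n : ℕ}

/-- `E(T) = ⨂_v E(Out(v), in(v))`, the tensor product over all vertices of `T`. For the exceptional
graph this is the empty tensor product. -/
def OnTree (T : DirTree m n) : Type _ :=
  PiTensorProduct k fun v : T.Vert => E.OnSets (T.Out v) (T.In v)

instance (T : DirTree m n) : AddCommGroup (E.OnTree T) :=
  inferInstanceAs (AddCommGroup (PiTensorProduct k fun v : T.Vert => E.OnSets (T.Out v) (T.In v)))

instance (T : DirTree m n) : Module k (E.OnTree T) :=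
  inferInstanceAs (Module k (PiTensorProduct k fun v : T.Vert => E.OnSets (T.Out v) (T.In v)))

/-- The map `E(G) → E(H)` induced by an isomorphism of graphs `φ : G ≅ H`. -/
def onGraphMap {G H : DirGraph m n} (φ : G.Iso H) :
    PiTensorProduct k (fun v : G.Vert => E.OnSets (G.Out v) (G.In v)) →ₗ[k]
      PiTensorProduct k (fun v : H.Vert => E.OnSets (H.Out v) (H.In v)) :=
  (show PiTensorProduct k (fun v : G.Vert => E.OnSets (H.Out (φ.vert v)) (H.In (φ.vert v))) →ₗ[k]
      PiTensorProduct k (fun v : H.Vert => E.OnSets (H.Out v) (H.In v)) from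
    (PiTensorProduct.reindex k (fun v : H.Vert => E.OnSets (H.Out v) (H.In v))
      φ.vert.symm).symm.toLinearMap) ∘ₗ
    PiTensorProduct.map (fun v : G.Vert => E.onSetsMap (φ.out v) (φ.in' v))

/-- The map `E(S) → E(T)` induced by an isomorphism `S ≅ T`. -/
def onTreeMap : {S T : DirTree m n} → S.Iso T → (E.OnTree S →ₗ[k] E.OnTree T)
  | .exceptional _ _, .exceptional _ _, _ => LinearMap.id
  | .ofGraph _ _, .ofGraph _ _, φ => E.onGraphMap φ
  | .exceptional _ _, .ofGraph _ _, φ => nomatch (show Empty from φ)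
  | .ofGraph _ _, .exceptional _ _, φ => nomatch (show Empty from φ)

open Classical in
/-- The relations `a ~ E(φ)(a)` that define the colimit. -/
def freeDioperadRel (m n : ℕ) : Submodule k (⨁ T : DirTree m n, E.OnTree T) :=
  Submodule.span k { x | ∃ (S T : DirTree m n) (φ : S.Iso T) (a : E.OnTree S),
    x = DirectSum.lof k (DirTree m n) (fun T => E.OnTree T) S a
      - DirectSum.lof k (DirTree m n) (fun T => E.OnTree T) T (E.onTreeMap φ a) }

/-- The component `Γ_D(E)(m,n)` of the free dioperad on `E`: the colimit of `T ↦ E(T)` over the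
category of extended connected simply connected directed `(m,n)`-graphs and their isomorphisms. -/
abbrev FreeDioperad (m n : ℕ) : Type _ :=
  (⨁ T : DirTree m n, E.OnTree T) ⧸ E.freeDioperadRel m n

open Classical in
/-- The canonical map `E(T) → Γ_D(E)(m,n)` into the colimit. -/
def toFreeDioperad (T : DirTree m n) : E.OnTree T →ₗ[k] E.FreeDioperad m n :=
  (E.freeDioperadRel m n).mkQ ∘ₗ DirectSum.lof k (DirTree m n) (fun T => E.OnTree T) T

end SigmaBimodule

end

/-! A vertex with at most two flags contributes a zero factor to `E(T)`, so only reduced trees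
matter in the colimit. Let `L = m + n`. Apart from `↑`, a tree satisfies `#Flag + 2 ≤ 2 #Vert + L`,
and reducedness gives `3 #Vert ≤ #Flag`. Hence `#Vert + 2 ≤ L` and `#Flag + 6 ≤ 3 L`, so there are
finitely many reduced trees up to isomorphism (`DirTree.finite_reduced`).

Reduced trees are rigid (`DirGraph.Iso.eq_of_isReduced`): two isomorphisms agree on the labelled
legs, these are the only possible leaves of the realization, and isomorphisms of finite trees that
agree on the leaves and at some point are equal. Thus no automorphisms have to be divided out, and
the colimit is the direct sum over representatives (`SigmaBimodule.bijective_toFreeDioperad`). Part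
1 follows, since each `E(T)` is then a finite tensor product of finite-dimensional spaces. -/

/-! ### Rigidity of finite trees relative to their leaves. -/

/-- Parents in a tree rooted at `s` are unique: shortest paths to `y` and `z`, each prolonged to
`x`, are two paths from `s` to `x`, hence the same path. -/
theorem SimpleGraph.IsTree.eq_of_adj_of_dist {V : Type*} {A : SimpleGraph V} (hA : A.IsTree)
    {s x y z : V} (hy : A.Adj x y) (hz : A.Adj x z) (dy : A.dist s x = A.dist s y + 1)
    (dz : A.dist s x = A.dist s z + 1) : y = z := by
  obtain ⟨p, hp, hpl⟩ := hA.1.exists_path_of_dist s y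
  obtain ⟨q, hq, hql⟩ := hA.1.exists_path_of_dist s z
  have hp' : (p.concat hy.symm).IsPath := by
    apply SimpleGraph.Walk.isPath_of_length_eq_dist
    rw [SimpleGraph.Walk.length_concat, hpl, dy]
  have hq' : (q.concat hz.symm).IsPath := by
    apply SimpleGraph.Walk.isPath_of_length_eq_dist
    rw [SimpleGraph.Walk.length_concat, hql, dz]
  exact (SimpleGraph.Walk.concat_inj ((hA.existsUnique_path s x).unique hp' hq')).1

/-- Two isomorphisms of finite trees that agree somewhere and at all leaves are equal. -/
theorem SimpleGraph.IsTree.iso_eq_of_eq_on_leaves {V W : Type*} [Finite V]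
    {A : SimpleGraph V} {B : SimpleGraph W} (hA : A.IsTree) (hB : B.IsTree) (f g : A ≃g B)
    (hr : ∃ r, f r = g r)
    (hleaf : ∀ x, f x = g x ∨ ∃ y z, y ≠ z ∧ A.Adj x y ∧ A.Adj x z) : ∀ x, f x = g x := by
  obtain ⟨r, hr⟩ := hr
  by_contra! hne
  have dist_map (h : A ≃g B) (x : V) : B.dist (h r) (h x) = A.dist r x := by
    refine le_antisymm ?_ ?_
    · obtain ⟨p, hp⟩ := hA.1.exists_walk_length_eq_dist r x
      rw [← hp, ← p.length_map h.toHom]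
      exact SimpleGraph.dist_le _
    · obtain ⟨p, hp⟩ := hB.1.exists_walk_length_eq_dist (h r) (h x)
      rw [← hp, ← p.length_map h.symm.toHom]
      have := SimpleGraph.dist_le (p.map h.symm.toHom)
      simpa using this
  -- Among the points of disagreement, `x` is farthest from `r`. Having two neighbours and at most
  -- one parent, it has a child, where `f` and `g` agree.
  obtain ⟨x, hx, hmax⟩ := Set.exists_max_image {x | f x ≠ g x} (A.dist r) (Set.toFinite _) hne
  have child : ∃ y, A.Adj x y ∧ A.dist r y = A.dist r x + 1 := by
    obtain h | ⟨y, z, hyz, hy, hz⟩ := hleaf x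
    · exact absurd h hx
    rcases hA.dist_eq_dist_add_one_of_adj r hy with h1 | h1
    · rcases hA.dist_eq_dist_add_one_of_adj r hz with h2 | h2
      · exact absurd (hA.eq_of_adj_of_dist hy hz h1 h2) hyz
      · exact ⟨z, hz, h2⟩
    · exact ⟨y, hy, h1⟩
  obtain ⟨y, hy, hd⟩ := child
  have hfy : f y = g y := by
    by_contra h
    have := hmax y h
    omega
  -- Both `f x` and `g x` are parents of `f y = g y` with respect to the root `f r = g r`.
  refine hx (hB.eq_of_adj_of_dist (s := f r) (x := f y) (f.map_adj_iff.2 hy.symm) ?_ ?_ ?_)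
  · rw [hfy]; exact g.map_adj_iff.2 hy.symm
  · rw [dist_map f, dist_map f, hd]
  · rw [dist_map f, hr, dist_map g, hd]

/-! ### Counting flags, and rigidity of reduced graphs. -/

namespace DirGraph

attribute [instance] DirGraph.finiteVert DirGraph.finiteFlag

variable {m n : ℕ}

theorem realization_adj_vert_flag (G : DirGraph m n) (v : G.Vert) (f : G.Flag) :
    G.realization.Adj (Sum.inl v) (Sum.inr f) ↔ G.root f = v := by
  simp [realization]

theorem realization_adj_flag_vert (G : DirGraph m n) (v : G.Vert) (f : G.Flag) :
    G.realization.Adj (Sum.inr f) (Sum.inl v) ↔ G.root f = v := by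
  simp [realization]

theorem realization_adj_flag_flag (G : DirGraph m n) (f g : G.Flag) :
    G.realization.Adj (Sum.inr f) (Sum.inr g) ↔ f ≠ g ∧ G.inv f = g := by
  simp only [realization, SimpleGraph.fromRel_adj, ne_eq, Sum.inr.injEq]
  refine and_congr_right fun _ => ⟨?_, Or.inl⟩
  rintro (h | h)
  · exact h
  · rw [← h, G.inv_inv]

theorem realization_not_adj_vert_vert (G : DirGraph m n) (v w : G.Vert) :
    ¬ G.realization.Adj (Sum.inl v) (Sum.inl w) := by
  simp [realization]

theorem card_legs (G : DirGraph m n) : Nat.card {f : G.Flag // G.inv f = f} = m + n := by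
  classical
  have e1 := Nat.card_congr G.outLabel
  have e2 := Nat.card_congr G.inLabel
  rw [Nat.card_fin] at e1 e2
  have e := Nat.card_congr (Equiv.sumCompl fun f : {f : G.Flag // G.inv f = f} => G.isOut f.1)
  rw [Nat.card_sum, Nat.card_congr (Equiv.subtypeSubtypeEquivSubtypeInter
    (fun f : G.Flag => G.inv f = f) G.isOut), Nat.card_congr
    (Equiv.subtypeSubtypeEquivSubtypeInter (fun f : G.Flag => G.inv f = f) fun f => ¬ G.isOut f),
    e1, e2] at e
  exact e.symm

theorem card_out_add_card_in (G : DirGraph m n) (v : G.Vert) :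
    Nat.card (G.Out v) + Nat.card (G.In v) = Nat.card {f : G.Flag // G.root f = v} := by
  classical
  have e := Nat.card_congr (Equiv.sumCompl fun f : {f : G.Flag // G.root f = v} => G.isOut f.1)
  rwa [Nat.card_sum, Nat.card_congr (Equiv.subtypeSubtypeEquivSubtypeInter
    (fun f : G.Flag => G.root f = v) G.isOut), Nat.card_congr
    (Equiv.subtypeSubtypeEquivSubtypeInter (fun f : G.Flag => G.root f = v) fun f => ¬ G.isOut f)]
    at e

/-- In a tree, `#Flag + 2 ≤ 2 #Vert + #legs`. -/
theorem IsSimplyConnected.card_flag_le {G : DirGraph m n} (hG : G.IsSimplyConnected) :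
    Nat.card G.Flag + 2 ≤ 2 * Nat.card G.Vert + (m + n) := by
  classical
  have := Fintype.ofFinite G.Vert
  have := Fintype.ofFinite G.Flag
  -- The degree sum of this tree is `2 (#Vert + #Flag - 1)`. The vertex points contribute `#Flag`; a
  -- flag point contributes at least 2, or at least 1 if it is a leg. So `3 #Flag - (m + n)` is a
  -- lower bound for the sum.
  have hT : G.realization.IsTree := ⟨hG.1, hG.2⟩
  have h1 := hT.card_edgeFinset
  have h2 := G.realization.sum_degrees_eq_twice_card_edges
  rw [Fintype.sum_sum_type] at h2
  have h3 : ∑ v : G.Vert, G.realization.degree (Sum.inl v) = Fintype.card G.Flag := by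
    rw [← Finset.card_univ, Finset.card_eq_sum_card_fiberwise (f := G.root) (t := Finset.univ)
      (fun _ _ => Finset.mem_univ _)]
    refine Finset.sum_congr rfl fun v _ => ?_
    rw [← SimpleGraph.card_neighborFinset_eq_degree]
    refine (congrArg Finset.card ?_).trans
      (Finset.card_map (Function.Embedding.inr (α := G.Vert)))
    ext (w | f)
    · simp [realization_not_adj_vert_vert]
    · simp [realization_adj_vert_flag]
  have h4 : ∀ f : G.Flag,
      2 ≤ G.realization.degree (Sum.inr f) + if G.inv f = f then 1 else 0 := by
    intro f
    rw [← SimpleGraph.card_neighborFinset_eq_degree]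
    split_ifs with h
    · refine Nat.succ_le_succ (Finset.card_pos.2 ⟨Sum.inl (G.root f), ?_⟩)
      simp [realization_adj_flag_vert]
    · refine Finset.one_lt_card.2 ⟨Sum.inl (G.root f), ?_, Sum.inr (G.inv f), ?_, by simp⟩
      · simp [realization_adj_flag_vert]
      · simp [realization_adj_flag_flag, Ne.symm h]
  have h5 := Finset.sum_le_sum fun (f : G.Flag) (_ : f ∈ Finset.univ) => h4 f
  rw [Finset.sum_add_distrib, ← Finset.card_filter, ← Fintype.card_subtype,
    ← Nat.card_eq_fintype_card (α := {f : G.Flag // G.inv f = f}), G.card_legs] at h5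
  simp only [Finset.sum_const, Finset.card_univ, smul_eq_mul] at h5
  rw [Fintype.card_sum] at h1
  rw [Nat.card_eq_fintype_card, Nat.card_eq_fintype_card]
  omega

/-- The fibres of `root` partition the flags. Against `IsSimplyConnected.card_flag_le`, this bounds
`#Vert` and `#Flag` in terms of `m + n`. -/
theorem three_mul_card_vert_le {G : DirGraph m n}
    (h : ∀ v : G.Vert, 3 ≤ Nat.card (G.Out v) + Nat.card (G.In v)) :
    3 * Nat.card G.Vert ≤ Nat.card G.Flag := by
  have := Fintype.ofFinite G.Vert
  rw [Nat.card_congr (Equiv.sigmaFiberEquiv G.root).symm, Nat.card_sigma,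
    Nat.card_eq_fintype_card, mul_comm, ← smul_eq_mul, ← Finset.card_univ]
  exact Finset.card_nsmul_le_sum _ _ _ fun v _ => (h v).trans_eq (G.card_out_add_card_in v)

/-- The isomorphism of realizations induced by an isomorphism of graphs. -/
def Iso.realization {G H : DirGraph m n} (φ : G.Iso H) : G.realization ≃g H.realization where
  toEquiv := Equiv.sumCongr φ.vert φ.flag
  map_rel_iff' := by
    rintro (v | f) (w | g)
    · simp [realization_not_adj_vert_vert]
    · simp [realization_adj_vert_flag, φ.root_flag]
    · simp [realization_adj_flag_vert, φ.root_flag]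
    · simp [realization_adj_flag_flag, φ.inv_flag]

/-- A leg is determined by its direction and its label, and isomorphisms preserve both. -/
theorem Iso.flag_eq_of_leg {G H : DirGraph m n} (φ ψ : G.Iso H) {f : G.Flag} (hf : G.inv f = f) :
    φ.flag f = ψ.flag f := by
  have hφ : H.inv (φ.flag f) = φ.flag f := by rw [φ.inv_flag, hf]
  have hψ : H.inv (ψ.flag f) = ψ.flag f := by rw [ψ.inv_flag, hf]
  by_cases ho : G.isOut f
  · have h1 := φ.outLabel_flag ⟨f, hf, ho⟩ ⟨φ.flag f, hφ, (φ.isOut_flag f).2 ho⟩ rfl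
    have h2 := ψ.outLabel_flag ⟨f, hf, ho⟩ ⟨ψ.flag f, hψ, (ψ.isOut_flag f).2 ho⟩ rfl
    exact congrArg Subtype.val (H.outLabel.injective (h1.trans h2.symm))
  · have h1 := φ.inLabel_flag ⟨f, hf, ho⟩ ⟨φ.flag f, hφ, fun h => ho ((φ.isOut_flag f).1 h)⟩ rfl
    have h2 := ψ.inLabel_flag ⟨f, hf, ho⟩ ⟨ψ.flag f, hψ, fun h => ho ((ψ.isOut_flag f).1 h)⟩ rfl
    exact congrArg Subtype.val (H.inLabel.injective (h1.trans h2.symm))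

/-- Isomorphisms between reduced directed trees are unique. -/
theorem Iso.eq_of_isReduced {G H : DirGraph m n} (hG : G.IsSimplyConnected)
    (hH : H.IsSimplyConnected)
    (h : ∀ v : G.Vert, 3 ≤ Nat.card (G.Out v) + Nat.card (G.In v)) (φ ψ : G.Iso H) : φ = ψ := by
  have hvert : 0 < Nat.card G.Vert := by
    obtain ⟨v | f⟩ := hG.1.nonempty
    · exact Nat.card_pos_iff.2 ⟨⟨v⟩, inferInstance⟩
    · exact Nat.card_pos_iff.2 ⟨⟨G.root f⟩, inferInstance⟩
  -- The two counts give `#Vert + 2 ≤ m + n`; any leg then serves as the point where `φ` and `ψ`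
  -- agree.
  have hlegs : 0 < Nat.card {f : G.Flag // G.inv f = f} := by
    have h1 := hG.card_flag_le
    have h2 := three_mul_card_vert_le h
    rw [card_legs]
    omega
  obtain ⟨⟨⟨l, hl⟩⟩, -⟩ := Nat.card_pos_iff.1 hlegs
  -- Only legs can be leaves: a vertex is adjacent to at least three flags, and a flag of an edge is
  -- adjacent to its vertex and to the opposite flag.
  have key := SimpleGraph.IsTree.iso_eq_of_eq_on_leaves ⟨hG.1, hG.2⟩ ⟨hH.1, hH.2⟩
    φ.realization ψ.realization
    ⟨Sum.inr l, congrArg Sum.inr (φ.flag_eq_of_leg ψ hl)⟩ (by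
      rintro (v | f)
      · have hv : 1 < Nat.card {f : G.Flag // G.root f = v} := by
          have := h v
          rw [card_out_add_card_in] at this
          omega
        have := Finite.one_lt_card_iff_nontrivial.1 hv
        obtain ⟨a, b, hab⟩ := exists_pair_ne {f : G.Flag // G.root f = v}
        exact Or.inr ⟨Sum.inr a, Sum.inr b, by simpa [Subtype.ext_iff] using hab,
          (G.realization_adj_vert_flag _ _).2 a.2, (G.realization_adj_vert_flag _ _).2 b.2⟩
      · by_cases hf : G.inv f = f
        · exact Or.inl (congrArg Sum.inr (φ.flag_eq_of_leg ψ hf))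
        · exact Or.inr ⟨Sum.inl (G.root f), Sum.inr (G.inv f), by simp,
            (G.realization_adj_flag_vert _ _).2 rfl,
            (G.realization_adj_flag_flag _ _).2 ⟨Ne.symm hf, rfl⟩⟩)
  have hv : φ.vert = ψ.vert := Equiv.ext fun v => Sum.inl_injective (key (Sum.inl v))
  have hf : φ.flag = ψ.flag := Equiv.ext fun f => Sum.inr_injective (key (Sum.inr f))
  cases φ
  cases ψ
  cases hv
  cases hf
  rfl

/-! ### The groupoid of graphs, and encoding of graphs by finite data. -/

/-- The identity. -/
def Iso.refl (G : DirGraph m n) : G.Iso G where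
  vert := Equiv.refl _
  flag := Equiv.refl _
  root_flag _ := rfl
  inv_flag _ := rfl
  isOut_flag _ := Iff.rfl
  outLabel_flag f f' h := by rw [show f' = f from Subtype.ext h]
  inLabel_flag f f' h := by rw [show f' = f from Subtype.ext h]

/-- The inverse of an isomorphism. -/
def Iso.symm {G H : DirGraph m n} (φ : G.Iso H) : H.Iso G where
  vert := φ.vert.symm
  flag := φ.flag.symm
  root_flag f := by
    rw [Equiv.eq_symm_apply, ← φ.root_flag, Equiv.apply_symm_apply]
  inv_flag f := by
    rw [Equiv.eq_symm_apply, ← φ.inv_flag, Equiv.apply_symm_apply]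
  isOut_flag f := by
    rw [← φ.isOut_flag, Equiv.apply_symm_apply]
  outLabel_flag f f' h :=
    (φ.outLabel_flag f' f (by rw [h, Equiv.apply_symm_apply])).symm
  inLabel_flag f f' h :=
    (φ.inLabel_flag f' f (by rw [h, Equiv.apply_symm_apply])).symm

/-- The composition of isomorphisms. -/
def Iso.trans {G H K : DirGraph m n} (φ : G.Iso H) (ψ : H.Iso K) : G.Iso K where
  vert := φ.vert.trans ψ.vert
  flag := φ.flag.trans ψ.flag
  root_flag f := by simp [ψ.root_flag, φ.root_flag]
  inv_flag f := by simp [ψ.inv_flag, φ.inv_flag]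
  isOut_flag f := by simp [ψ.isOut_flag, φ.isOut_flag]
  outLabel_flag f f' h := by
    have h1 : H.inv (φ.flag f.1) = φ.flag f.1 := by rw [φ.inv_flag, f.2.1]
    rw [ψ.outLabel_flag ⟨φ.flag f.1, h1, (φ.isOut_flag _).2 f.2.2⟩ f' h,
      φ.outLabel_flag f _ rfl]
  inLabel_flag f f' h := by
    have h1 : H.inv (φ.flag f.1) = φ.flag f.1 := by rw [φ.inv_flag, f.2.1]
    rw [ψ.inLabel_flag ⟨φ.flag f.1, h1, fun h => f.2.2 ((φ.isOut_flag _).1 h)⟩ f' h,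
      φ.inLabel_flag f _ rfl]

/-- Directed graph data on `a` vertices and `b` flags, with the labellings recorded as relations. -/
abbrev Shape (m n a b : ℕ) : Type :=
  (Fin b → Fin a) × (Fin b → Fin b) × (Fin b → Prop) × (Fin b → Fin m → Prop) ×
    (Fin b → Fin n → Prop)

/-- `s` describes `G` with respect to the given numberings of vertices and flags. -/
def IsShape (G : DirGraph m n) {a b : ℕ} (s : Shape m n a b) (eV : G.Vert ≃ Fin a)
    (eF : G.Flag ≃ Fin b) : Prop :=
  (∀ f, s.1 (eF f) = eV (G.root f)) ∧ (∀ f, s.2.1 (eF f) = eF (G.inv f)) ∧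
    (∀ f, s.2.2.1 (eF f) ↔ G.isOut f) ∧
    (∀ f i, s.2.2.2.1 (eF f) i ↔ ∃ h, G.outLabel ⟨f, h⟩ = i) ∧
    ∀ f i, s.2.2.2.2 (eF f) i ↔ ∃ h, G.inLabel ⟨f, h⟩ = i

theorem exists_isShape (G : DirGraph m n) {a b : ℕ} (eV : G.Vert ≃ Fin a) (eF : G.Flag ≃ Fin b) :
    ∃ s : Shape m n a b, G.IsShape s eV eF :=
  ⟨⟨fun x => eV (G.root (eF.symm x)), fun x => eF (G.inv (eF.symm x)),
    fun x => G.isOut (eF.symm x), fun x i => ∃ h, G.outLabel ⟨eF.symm x, h⟩ = i,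
    fun x i => ∃ h, G.inLabel ⟨eF.symm x, h⟩ = i⟩, by
    refine ⟨?_, ?_, ?_, ?_, ?_⟩ <;> intro f <;> simp⟩

/-- Graphs with the same shape are isomorphic. -/
def IsShape.iso {G H : DirGraph m n} {a b : ℕ} {s : Shape m n a b} {eV : G.Vert ≃ Fin a}
    {eF : G.Flag ≃ Fin b} {eV' : H.Vert ≃ Fin a} {eF' : H.Flag ≃ Fin b}
    (hG : G.IsShape s eV eF) (hH : H.IsShape s eV' eF') : G.Iso H where
  vert := eV.trans eV'.symm
  flag := eF.trans eF'.symm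
  root_flag f := by
    simp [Equiv.eq_symm_apply, ← hH.1, hG.1]
  inv_flag f := by
    simp [Equiv.eq_symm_apply, ← hH.2.1, hG.2.1]
  isOut_flag f := by
    simp [← hH.2.2.1, hG.2.2.1]
  outLabel_flag f f' h := by
    have h1 := (hG.2.2.2.1 f.1 _).2 ⟨f.2, rfl⟩
    rw [show eF f.1 = eF' f'.1 by simp [h], hH.2.2.2.1] at h1
    exact h1.2
  inLabel_flag f f' h := by
    have h1 := (hG.2.2.2.2 f.1 _).2 ⟨f.2, rfl⟩
    rw [show eF f.1 = eF' f'.1 by simp [h], hH.2.2.2.2] at h1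
    exact h1.2

end DirGraph

/-! ### Finiteness of the set of isomorphism classes of reduced trees. -/

namespace DirTree

variable {m n : ℕ}

/-- The identity. -/
def Iso.refl : (T : DirTree m n) → T.Iso T
  | exceptional _ _ => ()
  | ofGraph G _ => DirGraph.Iso.refl G

/-- The inverse of an isomorphism. -/
def Iso.symm : {S T : DirTree m n} → S.Iso T → T.Iso S
  | exceptional _ _, exceptional _ _, _ => ()
  | ofGraph _ _, ofGraph _ _, φ => DirGraph.Iso.symm φ
  | exceptional _ _, ofGraph _ _, φ => nomatch (show Empty from φ)
  | ofGraph _ _, exceptional _ _, φ => nomatch (show Empty from φ)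

/-- The composition of isomorphisms. -/
def Iso.trans : {S T U : DirTree m n} → S.Iso T → T.Iso U → S.Iso U
  | exceptional _ _, exceptional _ _, exceptional _ _, _, _ => ()
  | ofGraph _ _, ofGraph _ _, ofGraph _ _, φ, ψ => DirGraph.Iso.trans φ ψ
  | exceptional _ _, ofGraph _ _, _, φ, _ => nomatch (show Empty from φ)
  | ofGraph _ _, exceptional _ _, _, φ, _ => nomatch (show Empty from φ)
  | _, exceptional _ _, ofGraph _ _, _, ψ => nomatch (show Empty from ψ)
  | _, ofGraph _ _, exceptional _ _, _, ψ => nomatch (show Empty from ψ)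

theorem IsReduced.subsingleton_iso {S T : DirTree m n} (hS : S.IsReduced) :
    Subsingleton (S.Iso T) := by
  match S, T, hS with
  | exceptional _ _, exceptional _ _, _ => exact inferInstanceAs (Subsingleton Unit)
  | exceptional _ _, ofGraph _ _, _ => exact inferInstanceAs (Subsingleton Empty)
  | ofGraph _ _, exceptional _ _, _ => exact inferInstanceAs (Subsingleton Empty)
  | ofGraph _ hG, ofGraph _ hH, hS =>
    exact ⟨fun φ ψ => DirGraph.Iso.eq_of_isReduced hG hH hS φ ψ⟩

theorem IsReduced.of_iso {S T : DirTree m n} (φ : S.Iso T) (hT : T.IsReduced) : S.IsReduced := by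
  match S, T, φ, hT with
  | exceptional _ _, _, _, _ => exact fun v => nomatch (show Empty from v)
  | ofGraph _ _, exceptional _ _, φ, _ => exact nomatch (show Empty from φ)
  | ofGraph _ _, ofGraph _ _, φ, hT =>
    intro v
    have h := hT (DirGraph.Iso.vert φ v)
    have e1 := Nat.card_congr (DirGraph.Iso.out φ v)
    have e2 := Nat.card_congr (DirGraph.Iso.in' φ v)
    exact h.trans_eq (congrArg₂ (· + ·) e1 e2).symm

instance (T : DirTree m n) : Finite T.Vert :=
  match T with
  | exceptional _ _ => inferInstanceAs (Finite Empty)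
  | ofGraph G _ => G.finiteVert

instance (T : DirTree m n) (v : T.Vert) : Finite (T.Out v) :=
  match T, v with
  | exceptional _ _, v => nomatch (show Empty from v)
  | ofGraph G _, v => inferInstanceAs (Finite (G.Out v))

instance (T : DirTree m n) (v : T.Vert) : Finite (T.In v) :=
  match T, v with
  | exceptional _ _, v => nomatch (show Empty from v)
  | ofGraph G _, v => inferInstanceAs (Finite (G.In v))

variable (m n) in
/-- The reduced directed `(m,n)`-trees. -/
abbrev Reduced : Type 1 := {T : DirTree m n // T.IsReduced}

variable (m n) in
/-- Isomorphism of reduced directed trees. -/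
instance Reduced.setoid : Setoid (Reduced m n) where
  r S T := Nonempty (S.1.Iso T.1)
  iseqv := ⟨fun S => ⟨Iso.refl S.1⟩, fun ⟨φ⟩ => ⟨φ.symm⟩, fun ⟨φ⟩ ⟨ψ⟩ => ⟨φ.trans ψ⟩⟩

/-- There are only finitely many isomorphism classes of reduced directed `(m,n)`-trees. -/
theorem finite_reduced (m n : ℕ) : Finite (Quotient (Reduced.setoid m n)) := by
  -- `none` encodes `↑`. The bounds `#Vert ≤ m + n` and `#Flag ≤ 3 (m + n)` are not sharp but make
  -- this type of codes finite.
  let C := Option (Σ a : Fin (m + n + 1), Σ b : Fin (3 * (m + n) + 1), DirGraph.Shape m n a b)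
  have key : ∀ S : Reduced m n, ∃ c : C,
      match c, S.1 with
      | none, exceptional _ _ => True
      | some ⟨_, _, s⟩, ofGraph G _ => ∃ eV eF, G.IsShape s eV eF
      | _, _ => False := by
    rintro ⟨hm | ⟨G, hG⟩, hS⟩
    · exact ⟨none, trivial⟩
    · have h1 := hG.card_flag_le
      have h2 := DirGraph.three_mul_card_vert_le hS
      have eV := Finite.equivFin G.Vert
      have eF := Finite.equivFin G.Flag
      obtain ⟨s, hs⟩ := G.exists_isShape eV eF
      exact ⟨some ⟨⟨Nat.card G.Vert, by omega⟩, ⟨Nat.card G.Flag, by omega⟩, s⟩, eV, eF, hs⟩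
  choose c hc using key
  refine Finite.of_injective (fun q : Quotient (Reduced.setoid m n) => c q.out) fun q q' h => ?_
  rw [← q.out_eq, ← q'.out_eq]
  refine Quotient.sound ?_
  have h1 := hc q.out
  have h2 := hc q'.out
  change c q.out = c q'.out at h
  rw [← h] at h2
  change Nonempty (q.out.1.Iso q'.out.1)
  -- With the common code and both trees as variables, the match discards the mismatched cases,
  -- where `h1` or `h2` is `False`.
  generalize c q.out = x at h1 h2
  generalize q.out.1 = S at h1
  generalize q'.out.1 = T at h2
  match x, S, T, h1, h2 with
  | none, exceptional _ _, exceptional _ _, _, _ => exact ⟨()⟩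
  | some ⟨_, _, s⟩, ofGraph G _, ofGraph H _, ⟨_, _, h1⟩, ⟨_, _, h2⟩ => exact ⟨h1.iso h2⟩

theorem exists_representatives (m n : ℕ) : ∃ (r : ℕ) (T : Fin r → DirTree m n),
    (∀ i, (T i).IsReduced) ∧
    ∀ S : DirTree m n, S.IsReduced → ∃! i, Nonempty (S.Iso (T i)) := by
  have := finite_reduced m n
  let e := Finite.equivFin (Quotient (Reduced.setoid m n))
  refine ⟨_, fun i => (e.symm i).out.1, fun i => (e.symm i).out.2, fun S hS =>
    ⟨e ⟦⟨S, hS⟩⟧, ?_, fun i hi => ?_⟩⟩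
  · change Nonempty (S.Iso (e.symm (e ⟦⟨S, hS⟩⟧)).out.1)
    rw [Equiv.symm_apply_apply]
    exact Setoid.symm (Quotient.mk_out (⟨S, hS⟩ : Reduced m n))
  · have h : (⟦⟨S, hS⟩⟧ : Quotient (Reduced.setoid m n)) = ⟦(e.symm i).out⟧ := Quotient.sound hi
    rw [h, Quotient.out_eq, Equiv.apply_symm_apply]

end DirTree

/-! ### Finiteness, vanishing and functoriality of `E(Y,X)` and `E(T)`. -/

/-- Because the sizes are forced, there are finitely many frames on finite sets, and only one
component `E(m,n)` enters `E(Y,X)`. -/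
theorem Frame.card_eq {Y X : Type} (p : Frame Y X) : p.m = Nat.card Y ∧ p.n = Nat.card X :=
  ⟨by rw [← Nat.card_congr p.outB, Nat.card_fin], by rw [Nat.card_congr p.inB, Nat.card_fin]⟩

instance {Y X : Type} [Finite Y] [Finite X] : Finite (Frame Y X) := by
  refine Finite.of_injective
    (fun p : Frame Y X => ((⟨fun i => p.outB (i.cast p.card_eq.1.symm),
      fun x => (p.inB x).cast p.card_eq.2⟩ :
      (Fin (Nat.card Y) → Y) × (X → Fin (Nat.card X))))) ?_
  intro p q h
  have hp := p.card_eq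
  have hq := q.card_eq
  obtain ⟨m, n, β, α⟩ := p
  obtain ⟨m', n', β', α'⟩ := q
  obtain rfl : m = m' := hp.1.trans hq.1.symm
  obtain rfl : n = n' := hp.2.trans hq.2.symm
  obtain ⟨h1, h2⟩ := Prod.ext_iff.1 h
  congr 1
  · ext i
    simpa using congrFun h1 (i.cast hp.1)
  · ext x
    simpa using congrArg Fin.val (congrFun h2 x)

namespace SigmaBimodule

variable {k : Type w} [CommRing k] (E : SigmaBimodule.{u} k)

theorem finite_onSets {Y X : Type} [Finite Y] [Finite X]
    (h : ∀ m n, Module.Finite k (E.carrier m n)) : Module.Finite k (E.OnSets Y X) := by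
  classical
  have := Fintype.ofFinite (Frame Y X)
  have : Module.Finite k (E.PreOnSets Y X) := inferInstance
  infer_instance

theorem subsingleton_onSets {Y X : Type}
    (h : Subsingleton (E.carrier (Nat.card Y) (Nat.card X))) : Subsingleton (E.OnSets Y X) := by
  have h' (p : Frame Y X) : Subsingleton (E.carrier p.m p.n) := by
    rw [p.card_eq.1, p.card_eq.2]
    exact h
  have : Subsingleton (E.PreOnSets Y X) := ⟨fun a b => DFinsupp.ext fun p => (h' p).elim _ _⟩
  exact (Submodule.mkQ_surjective (E.onSetsRel Y X)).subsingleton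

theorem onSetsMap_refl (Y X : Type) :
    E.onSetsMap (Equiv.refl Y) (Equiv.refl X) = LinearMap.id := by
  classical
  refine Submodule.linearMap_qext _ (DirectSum.linearMap_ext _ fun p => LinearMap.ext fun e => ?_)
  simp only [onSetsMap, preOnSetsMap, LinearMap.comp_apply, Submodule.mkQ_apply,
    Submodule.mapQ_apply]
  rw [DirectSum.toModule_lof]
  rfl

theorem onSetsMap_comp {Y X Y' X' Y'' X'' : Type} (f : Y ≃ Y') (g : X ≃ X') (f' : Y' ≃ Y'')
    (g' : X' ≃ X'') (x : E.OnSets Y X) :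
    E.onSetsMap f' g' (E.onSetsMap f g x) = E.onSetsMap (f.trans f') (g.trans g') x := by
  classical
  refine LinearMap.congr_fun (f := E.onSetsMap f' g' ∘ₗ E.onSetsMap f g) ?_ x
  refine Submodule.linearMap_qext _ (DirectSum.linearMap_ext _ fun p => LinearMap.ext fun e => ?_)
  simp only [onSetsMap, preOnSetsMap, LinearMap.comp_apply, Submodule.mkQ_apply,
    Submodule.mapQ_apply]
  rw [DirectSum.toModule_lof, DirectSum.toModule_lof, DirectSum.toModule_lof]
  rfl

variable {m n : ℕ}

/-- Prescribing `y` at the points `φ.vert v`, rather than through `φ.vert.symm`, avoids transport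
between dependent factors. Functoriality is checked on pure tensors in this form. -/
theorem onGraphMap_tprod {G H : DirGraph m n} (φ : G.Iso H)
    (x : ∀ v, E.OnSets (G.Out v) (G.In v)) (y : ∀ v, E.OnSets (H.Out v) (H.In v))
    (h : ∀ v, y (φ.vert v) = E.onSetsMap (φ.out v) (φ.in' v) (x v)) :
    E.onGraphMap φ (PiTensorProduct.tprod k x) = PiTensorProduct.tprod k y := by
  unfold onGraphMap
  rw [LinearMap.comp_apply, PiTensorProduct.map_tprod]
  refine (LinearEquiv.symm_apply_eq _).2 ?_
  rw [PiTensorProduct.reindex_tprod]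
  exact congrArg _ (funext fun v => (h v).symm)

theorem exists_onSetsMap {G H : DirGraph m n} (φ : G.Iso H)
    (x : ∀ v, E.OnSets (G.Out v) (G.In v)) : ∃ y : ∀ v, E.OnSets (H.Out v) (H.In v),
    ∀ v, y (φ.vert v) = E.onSetsMap (φ.out v) (φ.in' v) (x v) :=
  ⟨φ.vert.piCongrLeft (fun v => E.OnSets (H.Out v) (H.In v))
    fun v => E.onSetsMap (φ.out v) (φ.in' v) (x v), fun v =>
    Equiv.piCongrLeft_apply_apply (fun v => E.OnSets (H.Out v) (H.In v)) _ _ v⟩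

theorem onGraphMap_refl (G : DirGraph m n) :
    E.onGraphMap (DirGraph.Iso.refl G) = LinearMap.id := by
  refine PiTensorProduct.ext (MultilinearMap.ext fun x => ?_)
  refine E.onGraphMap_tprod _ x x fun v => ?_
  exact (LinearMap.congr_fun (E.onSetsMap_refl _ _) (x v)).symm

theorem onGraphMap_trans {G H K : DirGraph m n} (φ : G.Iso H) (ψ : H.Iso K) :
    E.onGraphMap (φ.trans ψ) = E.onGraphMap ψ ∘ₗ E.onGraphMap φ := by
  refine PiTensorProduct.ext (MultilinearMap.ext fun x => ?_)
  obtain ⟨y, hy⟩ := E.exists_onSetsMap φ x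
  obtain ⟨z, hz⟩ := E.exists_onSetsMap ψ y
  change E.onGraphMap (φ.trans ψ) (PiTensorProduct.tprod k x) =
    E.onGraphMap ψ (E.onGraphMap φ (PiTensorProduct.tprod k x))
  rw [E.onGraphMap_tprod φ x y hy, E.onGraphMap_tprod ψ y z hz]
  refine E.onGraphMap_tprod _ x z fun v => ?_
  refine (hz (φ.vert v)).trans ?_
  rw [hy, onSetsMap_comp]
  rfl

theorem onTreeMap_refl (T : DirTree m n) :
    E.onTreeMap (DirTree.Iso.refl T) = LinearMap.id := by
  match T with
  | .exceptional _ _ => rfl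
  | .ofGraph G _ => exact E.onGraphMap_refl G

theorem onTreeMap_trans {S T U : DirTree m n} (φ : S.Iso T) (ψ : T.Iso U) (a : E.OnTree S) :
    E.onTreeMap (φ.trans ψ) a = E.onTreeMap ψ (E.onTreeMap φ a) := by
  match S, T, U, φ, ψ with
  | .exceptional _ _, .exceptional _ _, .exceptional _ _, _, _ => rfl
  | .ofGraph _ _, .ofGraph _ _, .ofGraph _ _, φ, ψ =>
    exact LinearMap.congr_fun (E.onGraphMap_trans φ ψ) a
  | .exceptional _ _, .ofGraph _ _, _, φ, _ => exact nomatch (show Empty from φ)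
  | .ofGraph _ _, .exceptional _ _, _, φ, _ => exact nomatch (show Empty from φ)
  | _, .exceptional _ _, .ofGraph _ _, _, ψ => exact nomatch (show Empty from ψ)
  | _, .ofGraph _ _, .exceptional _ _, _, ψ => exact nomatch (show Empty from ψ)

/-- A vertex violating reducedness has a zero factor, so every pure tensor has a zero coordinate
there. -/
theorem subsingleton_onTree (h : ∀ m n : ℕ, m + n ≤ 2 → Subsingleton (E.carrier m n))
    {T : DirTree m n} (hT : ¬ T.IsReduced) : Subsingleton (E.OnTree T) := by
  obtain ⟨v, hv⟩ := not_forall.1 hT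
  have := E.subsingleton_onSets (Y := T.Out v) (X := T.In v) (h _ _ (by omega))
  refine subsingleton_of_forall_eq 0 fun a => ?_
  refine LinearMap.congr_fun (f := LinearMap.id) (g := 0)
    (PiTensorProduct.ext (MultilinearMap.ext fun x => ?_)) a
  exact MultilinearMap.map_coord_zero (PiTensorProduct.tprod k) v (Subsingleton.elim _ _)

theorem finite_onTree (h : ∀ m n, Module.Finite k (E.carrier m n)) (T : DirTree m n) :
    Module.Finite k (E.OnTree T) := by
  have (v : T.Vert) : Module.Finite k (E.OnSets (T.Out v) (T.In v)) := E.finite_onSets h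
  exact inferInstanceAs
    (Module.Finite k (PiTensorProduct k fun v : T.Vert => E.OnSets (T.Out v) (T.In v)))

/-! ### The colimit as a direct sum over representatives. -/

theorem toFreeDioperad_onTreeMap {S T : DirTree m n} (φ : S.Iso T) (a : E.OnTree S) :
    E.toFreeDioperad T (E.onTreeMap φ a) = E.toFreeDioperad S a := by
  classical
  exact ((Submodule.Quotient.eq (E.freeDioperadRel m n)).2
    (Submodule.subset_span ⟨S, T, φ, a, rfl⟩)).symm

/-- For representatives `T i` of the isomorphism classes of reduced trees, the images of the two
legs of a commutative triangle of isomorphisms agree in the direct sum. -/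
theorem lof_onTreeMap_eq {r : ℕ} {T : Fin r → DirTree m n}
    (hT : ∀ S : DirTree m n, S.IsReduced → ∃! i, Nonempty (S.Iso (T i)))
    {S : DirTree m n} (hS : S.IsReduced) {i j : Fin r} (φ : S.Iso (T i)) (ψ : S.Iso (T j))
    (a : E.OnTree S) :
    DirectSum.lof k (Fin r) (fun i => E.OnTree (T i)) i (E.onTreeMap φ a) =
      DirectSum.lof k (Fin r) (fun i => E.OnTree (T i)) j (E.onTreeMap ψ a) := by
  obtain rfl : i = j := (hT S hS).unique ⟨φ⟩ ⟨ψ⟩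
  rw [hS.subsingleton_iso.elim φ ψ]

open Classical in
/-- The map that sends `E(S)`, for `S` reduced, to the summand of the representative of `S`. -/
noncomputable def toRepresentatives {r : ℕ} (T : Fin r → DirTree m n) (S : DirTree m n) :
    E.OnTree S →ₗ[k] ⨁ i, E.OnTree (T i) :=
  if h : ∃ i, Nonempty (S.Iso (T i)) then
    DirectSum.lof k (Fin r) (fun i => E.OnTree (T i)) h.choose ∘ₗ E.onTreeMap h.choose_spec.some
  else 0

/-- The choices in the definition do not matter: the index is unique, and by rigidity so is the
isomorphism, `S` being reduced along with `T i`. -/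
theorem toRepresentatives_eq {r : ℕ} {T : Fin r → DirTree m n}
    (hred : ∀ i, (T i).IsReduced)
    (hT : ∀ S : DirTree m n, S.IsReduced → ∃! i, Nonempty (S.Iso (T i)))
    {S : DirTree m n} {i : Fin r} (φ : S.Iso (T i)) (a : E.OnTree S) :
    E.toRepresentatives T S a =
      DirectSum.lof k (Fin r) (fun i => E.OnTree (T i)) i (E.onTreeMap φ a) := by
  have h : ∃ i, Nonempty (S.Iso (T i)) := ⟨i, ⟨φ⟩⟩
  rw [toRepresentatives, dif_pos h]
  exact E.lof_onTreeMap_eq hT ((hred i).of_iso φ) _ _ a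

/-- This compatibility lets the maps descend to the colimit. If `S'` is isomorphic to no
representative, neither is `S`, and both sides are zero. -/
theorem toRepresentatives_onTreeMap {r : ℕ} {T : Fin r → DirTree m n}
    (hred : ∀ i, (T i).IsReduced)
    (hT : ∀ S : DirTree m n, S.IsReduced → ∃! i, Nonempty (S.Iso (T i)))
    {S S' : DirTree m n} (φ : S.Iso S') (a : E.OnTree S) :
    E.toRepresentatives T S' (E.onTreeMap φ a) = E.toRepresentatives T S a := by
  by_cases h : ∃ i, Nonempty (S'.Iso (T i))
  · obtain ⟨i, ⟨ψ⟩⟩ := h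
    rw [E.toRepresentatives_eq hred hT ψ, E.toRepresentatives_eq hred hT (φ.trans ψ),
      onTreeMap_trans]
  · have h' : ¬ ∃ i, Nonempty (S.Iso (T i)) := fun ⟨i, ⟨ψ⟩⟩ => h ⟨i, ⟨φ.symm.trans ψ⟩⟩
    rw [toRepresentatives, dif_neg h, toRepresentatives, dif_neg h']
    rfl

/-- The free dioperad is the direct sum over representatives of the reduced trees. -/
theorem bijective_toFreeDioperad (h : ∀ m n : ℕ, m + n ≤ 2 → Subsingleton (E.carrier m n))
    {r : ℕ} {T : Fin r → DirTree m n} (hred : ∀ i, (T i).IsReduced)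
    (hT : ∀ S : DirTree m n, S.IsReduced → ∃! i, Nonempty (S.Iso (T i))) :
    Function.Bijective
      (DirectSum.toModule k (Fin r) (E.FreeDioperad m n) fun i => E.toFreeDioperad (T i)) := by
  classical
  constructor
  -- `ρ` is a left inverse of the canonical map; on the summand of `T i` this is seen from the
  -- identity isomorphism of `T i`.
  · let ρ := (E.freeDioperadRel m n).liftQ
      (DirectSum.toModule k (DirTree m n) (⨁ i, E.OnTree (T i)) fun S => E.toRepresentatives T S)
      (Submodule.span_le.2 (by
        rintro _ ⟨S, S', φ, a, rfl⟩
        rw [SetLike.mem_coe, LinearMap.mem_ker, map_sub, DirectSum.toModule_lof,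
          DirectSum.toModule_lof, E.toRepresentatives_onTreeMap hred hT φ a, sub_self]))
    refine Function.LeftInverse.injective (g := ρ) fun x => ?_
    refine LinearMap.congr_fun (f := ρ ∘ₗ DirectSum.toModule k (Fin r) (E.FreeDioperad m n)
      fun i => E.toFreeDioperad (T i)) (g := LinearMap.id)
      (DirectSum.linearMap_ext _ fun i => LinearMap.ext fun a => ?_) x
    rw [LinearMap.comp_apply, LinearMap.comp_apply, DirectSum.toModule_lof]
    refine (DirectSum.toModule_lof _ _ _).trans ?_
    rw [E.toRepresentatives_eq hred hT (DirTree.Iso.refl (T i)), onTreeMap_refl]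
    rfl
  · rw [← LinearMap.range_eq_top, eq_top_iff]
    rintro x -
    obtain ⟨x, rfl⟩ := Submodule.mkQ_surjective _ x
    induction x using DirectSum.induction_on with
    | zero => rw [map_zero]; exact zero_mem _
    | add x y hx hy => rw [map_add]; exact add_mem hx hy
    | of S a =>
      change E.toFreeDioperad S a ∈ _
      -- A reduced `S` is moved to its representative without changing the class of `a`; otherwise
      -- `E(S) = 0`.
      by_cases hS : S.IsReduced
      · obtain ⟨i, ⟨φ⟩⟩ := (hT S hS).exists
        refine ⟨DirectSum.lof k (Fin r) (fun i => E.OnTree (T i)) i (E.onTreeMap φ a), ?_⟩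
        rw [DirectSum.toModule_lof, toFreeDioperad_onTreeMap]
      · have := E.subsingleton_onTree h hS
        rw [Subsingleton.elim a 0, map_zero]
        exact zero_mem _

end SigmaBimodule

theorem mainTheorem9 {k : Type*} [Field k] (E : SigmaBimodule k)
    (hzero : ∀ m n : ℕ, m + n ≤ 2 → Subsingleton (E.carrier m n)) :
    ((∀ m n : ℕ, 2 < m + n → FiniteDimensional k (E.carrier m n)) →
      ∀ m n : ℕ, FiniteDimensional k (E.FreeDioperad m n)) ∧
    ∀ m n : ℕ, ∃ (r : ℕ) (T : Fin r → DirTree m n),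
      (∀ i, (T i).IsReduced) ∧
      (∀ S : DirTree m n, S.IsReduced → ∃! i, Nonempty (S.Iso (T i))) ∧
      Function.Bijective
        (DirectSum.toModule k (Fin r) (E.FreeDioperad m n) fun i => E.toFreeDioperad (T i)) := by
  refine ⟨fun hfin m n => ?_, fun m n => ?_⟩
  · obtain ⟨r, T, hred, hT⟩ := DirTree.exists_representatives m n
    have h (m n : ℕ) : Module.Finite k (E.carrier m n) := by
      by_cases hmn : m + n ≤ 2
      · have := hzero m n hmn
        infer_instance
      · exact hfin m n (by omega)
    have (i : Fin r) : Module.Finite k (E.OnTree (T i)) := E.finite_onTree h (T i)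
    exact Module.Finite.of_surjective _ (E.bijective_toFreeDioperad hzero hred hT).surjective
  · obtain ⟨r, T, hred, hT⟩ := DirTree.exists_representatives m n
    exact ⟨r, T, hred, hT, E.bijective_toFreeDioperad hzero hred hT⟩
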